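/- Let $H$ be a complex Hilbert space and let $M\subseteq B(H)$ be a von Neumann algebra. Let $M_*$ be the space of $\sigma$-weakly continuous linear functionals on $M$, let $M^+$ and $M_*^+$ be the cones of positive elements of $M$ and of positive functionals in $M_*$, and let $F$ be a nonempty $\sigma$-weakly closed convex subset of $M^+$ that is hereditary, i.e. $x\in F$ whenever $0\le x\le y$ in $M$ and $y\in F$. Let $$F^{r+}:=\{\omega\in M_*^+ : \omega(x)\le 1\text{ for all }x\in F\},\qquad F^{r+r+}:=\{x\in M^+ : \omega(x)\le 1\text{ for all }\omega\in F^{r+}\}$$ be its positive polar and positive bipolar, i.e. the positive parts of the real polars taken in the dual pair $(M^{sa},M_*^{sa})$ of self-adjoint elements and self-adjoint normal functionals. Then $$F=F^{r+r+}.$$ Equivalently, for every $x'\in M^+\setminus F$ there is $\omega\in M_*^+$ such that $\omega(x')>1$ and $\omega(x)\le 1$ for all $x\in F$. (Both forms are asserted.) -/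

import Mathlib

open scoped Topology ComplexOrder InnerProductSpace

/-- A subset `F` of the positive cone of a partially ordered vector space is hereditary if `x ∈ F`
whenever `0 ≤ x ≤ y` with `y ∈ F`. -/
def IsHereditary {E : Type*} [Zero E] [LE E] (F : Set E) : Prop :=
  ∀ ⦃x y : E⦄, 0 ≤ x → x ≤ y → y ∈ F → x ∈ F

namespace VonNeumannAlgebra

universe u

variable {H : Type u} [NormedAddCommGroup H] [InnerProductSpace ℂ H] [CompleteSpace H]

/-- A von Neumann algebra is a complex subspace of the bounded operators; with this, its elements
form a complex (hence also a real) vector space. -/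
instance instSMulMemClass : SMulMemClass (VonNeumannAlgebra H) ℂ (H →L[ℂ] H) where
  smul_mem {S} c _ hx := S.toStarSubalgebra.smul_mem hx c

/-- The `σ`-weak topology on a von Neumann algebra `M` of operators on `H`: the coarsest topology
making all functionals `x ↦ ∑ₙ ⟪ξₙ, x ηₙ⟫` continuous, where `ξ` and `η` are sequences in `H` with
`∑ₙ ‖ξₙ‖² < ∞` and `∑ₙ ‖ηₙ‖² < ∞`. -/
noncomputable abbrev sigmaWeak (M : VonNeumannAlgebra H) : TopologicalSpace M :=
  ⨅ (ξ : lp (fun _ : ℕ => H) 2) (η : lp (fun _ : ℕ => H) 2),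
    TopologicalSpace.induced (fun x : M => ∑' n, ⟪ξ n, (x : H →L[ℂ] H) (η n)⟫_ℂ) inferInstance

/-- The predual `M_*`: the space of `σ`-weakly continuous (i.e. normal) complex linear functionals
on `M`. -/
def predual (M : VonNeumannAlgebra H) : Submodule ℂ (M →ₗ[ℂ] ℂ) where
  carrier := {ω | Continuous[sigmaWeak M, inferInstance] ω}
  add_mem' {f g} hf hg := by
    let _ := sigmaWeak M
    exact Continuous.add hf hg
  zero_mem' := by
    let _ := sigmaWeak M
    exact continuous_const (y := (0 : ℂ))
  smul_mem' c f hf := by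
    let _ := sigmaWeak M
    exact Continuous.const_smul hf c

variable {M : VonNeumannAlgebra H}

/-- `M^+`: the positive operators in `M`. -/
def posCone (M : VonNeumannAlgebra H) : Set M := {x | 0 ≤ x}

/-- `M_*^{sa}`: the self-adjoint normal functionals. -/
def predualSA (M : VonNeumannAlgebra H) : Set M.predual :=
  {ω | ∀ x : M, ω.1 (star x) = star (ω.1 x)}

/-- `M_*^+`: the positive normal functionals. The order on `ℂ` is the usual one, so that `0 ≤ z`
says that `z` is real and nonnegative. -/
def predualPos (M : VonNeumannAlgebra H) : Set M.predual :=
  {ω | ∀ x ∈ M.posCone, 0 ≤ ω.1 x}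

/-- The real polar `F^r` of a set `F` of self-adjoint elements in the dual pair
`(M^{sa}, M_*^{sa})`. The pairing `ω(x)` is real for self-adjoint `x` and `ω`. -/
def realPolar (F : Set M) : Set M.predual :=
  {ω | ω ∈ M.predualSA ∧ ∀ x ∈ F, (ω.1 x).re ≤ 1}

/-- The real polar `G^r` of a set `G` of self-adjoint normal functionals in the dual pair
`(M_*^{sa}, M^{sa})`. -/
def realPrepolar (G : Set M.predual) : Set M :=
  {x | IsSelfAdjoint x ∧ ∀ ω ∈ G, (ω.1 x).re ≤ 1}

/-- The positive polar `F^{r+} = F^r ∩ M_*^+`. -/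
def posPolar (F : Set M) : Set M.predual := realPolar F ∩ M.predualPos

/-- The positive polar `G^{r+} = G^r ∩ M^+`. -/
def posPrepolar (G : Set M.predual) : Set M := realPrepolar G ∩ M.posCone

end VonNeumannAlgebra

/-! Let D = F - M^+, the elements of M dominated by a member of F. If a positive x₀ outside F can be
strictly separated from D by a self-adjoint normal functional, then that functional has a constant
sign on M^+ because D absorbs -M^+, and after a sign change and rescaling it is the required ω. The
bipolar identity follows.

The difficulty is σ-weak closedness: bounded elements of D may be dominated only by elements of F of
huge norm, so compactness cannot be applied directly. The remedy is the Yosida approximation x(1 +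
αx)⁻¹. It is operator monotone and bounded by 1/α on positive operators, so for small α it sends x ≤
y ∈ F to an element dominated by a member of F of norm at most 1/α (`yosida_mem_boundedLowerSet`).
The elements dominated in this bounded way form a weakly closed set, by compactness of F ∩ ball. The
approximation is strongly continuous on bounded sets, and strong and weak closures of convex sets
agree. Letting α → 0 shows that the norm closure of D has weakly closed bounded parts
(`isClosed_wot_closure_dominatedSet`), and that its positive elements lie in F
(`mem_of_mem_closure_dominatedSet`).

A Krein–Smulian argument (`Convex.exists_normal_separation`) then gives the separation: countably
many vector functionals map the convex set into c₀ outside the unit ball, and Hahn–Banach in c₀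
yields ℓ¹ coefficients, hence a normal functional. -/

open Filter

/-! ### Compactness of balls and closures of convex sets in the weak operator topology. -/

section WeakOperatorTopology

variable {H : Type*} [NormedAddCommGroup H] [InnerProductSpace ℂ H] [CompleteSpace H]

/-- Bounded sets of operators are relatively compact in the weak operator topology: the closed balls
around the origin are compact. -/
theorem ContinuousLinearMapWOT.isCompact_preimage_closedBall (r : ℝ) :
    IsCompact (toCLM ⁻¹' Metric.closedBall 0 r : Set (H →WOT[ℂ] H)) := by
  rw [isCompact_iff_ultrafilter_le_nhds]
  intro u hu
  rw [le_principal_iff] at hu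
  have hr : 0 ≤ r := by
    obtain ⟨A, hA⟩ := u.nonempty_of_mem hu
    exact (norm_nonneg _).trans (mem_closedBall_zero_iff.1 hA)
  have hbd (ξ η : H) : ∀ A ∈ (toCLM ⁻¹' Metric.closedBall 0 r : Set (H →WOT[ℂ] H)),
      ‖⟪A ξ, η⟫_ℂ‖ ≤ r * ‖ξ‖ * ‖η‖ := fun A hA ↦ by
    have hA : ‖A.toCLM‖ ≤ r := mem_closedBall_zero_iff.1 hA
    calc ‖⟪A ξ, η⟫_ℂ‖ ≤ ‖A.toCLM ξ‖ * ‖η‖ := norm_inner_le_norm _ _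
      _ ≤ _ := by gcongr; exact A.toCLM.le_of_opNorm_le hA ξ
  -- Each matrix coefficient is bounded along the ultrafilter, so it converges; the limits form a
  -- bounded sesquilinear form, which is represented by an operator.
  have hlim (ξ η : H) : ∃ z : ℂ, Tendsto (fun A : H →WOT[ℂ] H ↦ ⟪A ξ, η⟫_ℂ) u (𝓝 z) := by
    obtain ⟨z, -, hz⟩ := (isCompact_closedBall (0 : ℂ) (r * ‖ξ‖ * ‖η‖)).ultrafilter_le_nhds
      (u.map fun A ↦ ⟪A ξ, η⟫_ℂ) (by
        rw [le_principal_iff]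
        exact mem_map.2 (mem_of_superset hu fun A hA ↦ mem_closedBall_zero_iff.2 (hbd ξ η A hA)))
    exact ⟨z, hz⟩
  choose L hL using hlim
  have hLbd (ξ η : H) : ‖L ξ η‖ ≤ r * ‖ξ‖ * ‖η‖ :=
    le_of_tendsto (hL ξ η).norm (mem_of_superset hu (hbd ξ η))
  let B : H →L⋆[ℂ] H →L[ℂ] ℂ := LinearMap.mkContinuous₂
    (LinearMap.mk₂'ₛₗ (starRingEnd ℂ) (RingHom.id ℂ) L
      (fun a b c ↦ tendsto_nhds_unique (hL _ _) <| by
        simpa [inner_add_left] using (hL a c).add (hL b c))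
      (fun k a c ↦ tendsto_nhds_unique (hL _ _) <| by
        simpa [inner_smul_left, mul_comm] using (hL a c).const_mul (starRingEnd ℂ k))
      (fun a b c ↦ tendsto_nhds_unique (hL _ _) <| by
        simpa [inner_add_right] using (hL a b).add (hL a c))
      (fun k a c ↦ tendsto_nhds_unique (hL _ _) <| by
        simpa [inner_smul_right] using (hL a c).const_mul k))
    r hLbd
  let T := InnerProductSpace.continuousLinearMapOfBilin B
  have hT (ξ η : H) : ⟪T ξ, η⟫_ℂ = L ξ η :=
    InnerProductSpace.continuousLinearMapOfBilin_apply B ξ η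
  refine ⟨ofCLM T, ?_, ?_⟩
  · refine mem_closedBall_zero_iff.2 (ContinuousLinearMap.opNorm_le_of_re_inner_le hr ?_)
    intro x y hx hy
    calc RCLike.re ⟪T x, y⟫_ℂ ≤ ‖⟪T x, y⟫_ℂ‖ := RCLike.re_le_norm _
      _ ≤ r * ‖x‖ * ‖y‖ := hT x y ▸ hLbd x y
      _ = r := by simp [hx, hy]
  · change Tendsto id (u : Filter (H →WOT[ℂ] H)) _
    rw [tendsto_iff_forall_inner_apply_tendsto]
    intro x y
    have := (hL x y).star
    rw [← hT] at this
    simpa using this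

/-- A point in the closure of a convex set of operators for the weak operator topology lies in its
closure for the strong operator topology. -/
theorem Convex.exists_norm_apply_sub_lt_of_mem_closure_wot {S : Set (H →L[ℂ] H)}
    (hS : Convex ℝ S) {x : H →L[ℂ] H}
    (hx : ContinuousLinearMapWOT.ofCLM x ∈ closure (ContinuousLinearMapWOT.toCLM ⁻¹' S))
    (s : Finset H) {ε : ℝ} (hε : 0 < ε) : ∃ y ∈ S, ∀ ξ ∈ s, ‖y ξ - x ξ‖ < ε := by
  classical
  let ev : (H →L[ℂ] H) →ₗ[ℝ] (s → H) :=
    { toFun := fun y ξ ↦ y ξ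
      map_add' := fun _ _ ↦ rfl
      map_smul' := fun _ _ ↦ rfl }
  -- Only finitely many vectors matter, so one separates in the product H^s. By Riesz, a functional
  -- there pulls back to a finite sum of matrix coefficients, which is weakly continuous.
  have key : ev x ∈ closure (ev '' S) := by
    by_contra hcon
    obtain ⟨f, c, hf, hc⟩ := RCLike.geometric_hahn_banach_closed_point (𝕜 := ℂ)
      (hS.linear_image ev).closure isClosed_closure hcon
    let ζ : s → H := fun ξ ↦ (InnerProductSpace.toDual ℂ H).symm
      (f ∘L ContinuousLinearMap.single ℂ (fun _ : s ↦ H) ξ)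
    have hfe (y : H →L[ℂ] H) : f (ev y) = ∑ ξ : s, ⟪ζ ξ, y ξ⟫_ℂ := by
      have h1 : ev y = ∑ ξ : s, Pi.single ξ (y ξ) := (Finset.univ_sum_single (ev y)).symm
      rw [h1, map_sum]
      refine Finset.sum_congr rfl fun ξ _ ↦ ?_
      simp [ζ]
    have hcont : Continuous fun y : H →WOT[ℂ] H ↦ RCLike.re (f (ev y.toCLM)) := by
      simp only [hfe]
      refine RCLike.continuous_re.comp (continuous_finsetSum _ fun ξ _ ↦ ?_)
      exact ContinuousLinearMapWOT.continuous_dual_apply (ξ : H) (innerSL ℂ (ζ ξ))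
    have : RCLike.re (f (ev x)) ≤ c := by
      refine closure_minimal (s := ContinuousLinearMapWOT.toCLM ⁻¹' S)
        (t := {y : H →WOT[ℂ] H | RCLike.re (f (ev y.toCLM)) ≤ c}) (fun y hy ↦ ?_)
        (isClosed_le hcont continuous_const) hx
      exact (hf _ (subset_closure ⟨_, hy, rfl⟩)).le
    exact absurd hc this.not_gt
  obtain ⟨-, ⟨y, hy, rfl⟩, hd⟩ := Metric.mem_closure_iff.1 key ε hε
  refine ⟨y, hy, fun ξ hξ ↦ ?_⟩
  rw [← dist_eq_norm, dist_comm]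
  exact (dist_pi_lt_iff hε).1 hd ⟨ξ, hξ⟩

end WeakOperatorTopology

/-! ### Duality of c₀ and ℓ¹, and separation by null families. -/

section NullSequences

open scoped ZeroAtInfty

open ZeroAtInftyContinuousMap in
/-- Every bounded functional on the Banach space `c₀(ι)` is given by a summable family. -/
theorem ZeroAtInftyContinuousMap.exists_summable_hasSum {ι : Type*} [TopologicalSpace ι]
    [DiscreteTopology ι] (f : C₀(ι, ℝ) →L[ℝ] ℝ) :
    ∃ a : ι → ℝ, Summable (fun i ↦ |a i|) ∧ ∀ v : C₀(ι, ℝ), HasSum (fun i ↦ a i * v i) (f v) := by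
  classical
  have norm_le {v : C₀(ι, ℝ)} {c : ℝ} (hc : 0 ≤ c) (h : ∀ i, |v i| ≤ c) : ‖v‖ ≤ c := by
    rw [← norm_toBCF_eq_norm]
    exact (BoundedContinuousFunction.norm_le hc).2 h
  let e : ι → C₀(ι, ℝ) := fun i ↦
    { toFun := Pi.single i 1
      continuous_toFun := continuous_of_discreteTopology
      zero_at_infty' := by
        rw [cocompact_eq_cofinite]
        refine tendsto_const_nhds.congr' ?_
        filter_upwards [(Set.finite_singleton i).compl_mem_cofinite] with j hj
        have hj : j ≠ i := hj
        simp [hj] }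
  have he (i j : ι) : e i j = (Pi.single i 1 : ι → ℝ) j := rfl
  have eval (t : Finset ι) (c : ι → ℝ) (j : ι) :
      (∑ i ∈ t, c i • e i) j = if j ∈ t then c j else 0 := by
    have : (∑ i ∈ t, c i • e i) j = ∑ i ∈ t, c i * e i j := by
      induction t using Finset.induction_on with
      | empty => simp
      | insert a s ha ih => simp [Finset.sum_insert ha, ih]
    rw [this]
    simp [he, Pi.single_apply]
  refine ⟨fun i ↦ f (e i), ?_, fun v ↦ ?_⟩
  · refine summable_of_sum_le (c := ‖f‖) (fun i ↦ abs_nonneg _) fun t ↦ ?_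
    -- Testing f on a finitely supported sign vector, of norm at most 1, bounds the ℓ¹ norm of the
    -- coefficients by ‖f‖.
    have h1 : ∑ i ∈ t, |f (e i)| = f (∑ i ∈ t, (SignType.sign (f (e i)) : ℝ) • e i) := by
      simp [map_sum, sign_mul_self]
    rw [h1]
    refine (le_abs_self _).trans ((f.le_opNorm _).trans ?_)
    refine mul_le_of_le_one_right (norm_nonneg _) (norm_le zero_le_one fun j ↦ ?_)
    rw [eval]
    split_ifs
    · rcases lt_trichotomy (f (e j)) 0 with h | h | h <;> simp [h]
    · simp
  · have hv : HasSum (fun i ↦ v i • e i) v := by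
      rw [HasSum, SummationFilter.unconditional_filter, Metric.tendsto_atTop]
      intro ε hε
      have hz := v.zero_at_infty'
      rw [cocompact_eq_cofinite] at hz
      have hfin : {i | ¬ |v i| < ε / 2}.Finite := by
        have := hz.eventually (Metric.ball_mem_nhds 0 (half_pos hε))
        simpa [eventually_cofinite] using this
      refine ⟨hfin.toFinset, fun t ht ↦ ?_⟩
      rw [dist_eq_norm]
      refine (norm_le (half_pos hε).le fun j ↦ ?_).trans_lt (half_lt_self hε)
      rw [sub_apply, eval]
      split_ifs with hj
      · simpa using (half_pos hε).le
      · rw [zero_sub, abs_neg]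
        by_contra hcon
        exact hj (ht (hfin.mem_toFinset.2 fun h ↦ hcon h.le))
    simpa [mul_comm] using f.hasSum hv

/-- If a family of linear functionals tends to zero pointwise, and each point of a convex set is
moved out of the interval `[-1, 1]` by some member of the family, then an absolutely summable
combination of the family is bounded away from zero on the convex set. -/
theorem Convex.exists_summable_le_tsum {ι E : Type*} [AddCommGroup E] [Module ℝ E]
    (g : ι → E →ₗ[ℝ] ℝ) (hg : ∀ x, Tendsto (fun i ↦ g i x) cofinite (𝓝 0)) {C : Set E}
    (hC : Convex ℝ C) (hgC : ∀ x ∈ C, ∃ i, 1 < |g i x|) :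
    ∃ a : ι → ℝ, Summable (fun i ↦ |a i|) ∧ ∃ δ > 0, ∀ x ∈ C, δ ≤ ∑' i, a i * g i x := by
  rcases C.eq_empty_or_nonempty with rfl | ⟨x₀, hx₀⟩
  · exact ⟨0, by simp, 1, one_pos, by simp⟩
  let _ : TopologicalSpace ι := ⊥
  have : DiscreteTopology ι := ⟨rfl⟩
  let T : E →ₗ[ℝ] C₀(ι, ℝ) :=
    { toFun := fun x ↦
        { toFun := fun i ↦ g i x
          continuous_toFun := continuous_of_discreteTopology
          zero_at_infty' := by rw [cocompact_eq_cofinite]; exact hg x }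
      map_add' := fun x y ↦ by ext i; simp
      map_smul' := fun c x ↦ by ext i; simp }
  have hdisj : Disjoint (Metric.ball (0 : C₀(ι, ℝ)) 1) (T '' C) := by
    rw [Set.disjoint_left]
    rintro - hball ⟨x, hx, rfl⟩
    obtain ⟨i, hi⟩ := hgC x hx
    rw [mem_ball_zero_iff, ← ZeroAtInftyContinuousMap.norm_toBCF_eq_norm] at hball
    exact absurd hi (((T x).toBCF.norm_coe_le_norm i).trans_lt hball).not_gt
  obtain ⟨f, u, hfu, huf⟩ := geometric_hahn_banach_open (convex_ball _ _) Metric.isOpen_ball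
    (hC.linear_image T) hdisj
  obtain ⟨a, ha, haf⟩ := ZeroAtInftyContinuousMap.exists_summable_hasSum f
  refine ⟨a, ha, u, ?_, fun x hx ↦ ?_⟩
  · simpa using hfu 0 (Metric.mem_ball_self one_pos)
  · exact (huf _ ⟨x, hx, rfl⟩).trans_eq (haf (T x)).tsum_eq.symm

end NullSequences

/-! ### Krein–Smulian separation for self-adjoint operators. -/

section KreinSmulian

/-- Absolutely summable real combinations of uniformly bounded diagonal vector functionals, indexed
by a countable type, can be written with two square summable sequences of vectors. -/
theorem exists_lp_tsum_inner_eq {H : Type*} [NormedAddCommGroup H]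
    [InnerProductSpace ℂ H] {ι : Type*} [Countable ι] {a : ι → ℝ}
    (ha : Summable fun i ↦ |a i|) {v : ι → H} (hv : ∀ i, ‖v i‖ ≤ 1) :
    ∃ ξ η : lp (fun _ : ℕ ↦ H) 2, ∀ x : H →L[ℂ] H,
      ∑' n, ⟪ξ n, x (η n)⟫_ℂ = ∑' i, (a i : ℂ) * ⟪v i, x (v i)⟫_ℂ := by
  obtain ⟨j, hj⟩ := Countable.exists_injective_nat ι
  have memlp (c : ι → ℝ) (hc : ∀ i, |c i| ^ 2 ≤ |a i|) :
      Memℓp (E := fun _ : ℕ ↦ H) (Function.extend j (fun i ↦ (c i : ℂ) • v i) 0) 2 := by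
    rw [memℓp_gen_iff (by simp)]
    refine (hj.summable_iff fun n hn ↦ ?_).1 (ha.of_nonneg_of_le (fun i ↦ by simp) fun i ↦ ?_)
    · simp [Function.extend_apply' _ _ _ hn]
    · simp only [Function.comp, hj.extend_apply, ENNReal.toReal_ofNat, Real.rpow_ofNat, norm_smul,
        Complex.norm_real, Real.norm_eq_abs, mul_pow]
      refine (mul_le_of_le_one_right (by positivity) ?_).trans (hc i)
      exact pow_le_one₀ (norm_nonneg _) (hv i)
  -- Splitting a = (sign a · √|a|) · √|a| makes both factors square summable.
  refine ⟨⟨_, memlp (fun i ↦ SignType.sign (a i) * √|a i|) fun i ↦ ?_⟩,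
    ⟨_, memlp (fun i ↦ √|a i|) fun i ↦ ?_⟩, fun x ↦ ?_⟩
  · rcases lt_trichotomy (a i) 0 with h | h | h <;> simp [h]
  · simp
  · rw [← hj.tsum_eq]
    · refine tsum_congr fun i ↦ ?_
      simp only [hj.extend_apply, map_smul, inner_smul_left, inner_smul_right, Complex.conj_ofReal,
        ← mul_assoc, ← Complex.ofReal_mul]
      congr 2
      rw [mul_right_comm, Real.mul_self_sqrt (abs_nonneg _), abs_mul_sign]
    · intro n hn
      by_contra hcon
      exact hn (by simp [Function.extend_apply' _ _ _ hcon])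

variable {H : Type*} [NormedAddCommGroup H] [InnerProductSpace ℂ H] [CompleteSpace H]

/-- The norm of a self-adjoint operator is controlled by its quadratic form on the unit ball. -/
theorem IsSelfAdjoint.norm_le_of_abs_re_inner_le {x : H →L[ℂ] H} (hx : IsSelfAdjoint x) {c : ℝ}
    (hc : 0 ≤ c) (h : ∀ ξ : H, ‖ξ‖ ≤ 1 → |(⟪ξ, x ξ⟫_ℂ).re| ≤ c) : ‖x‖ ≤ c := by
  rw [x.norm_eq_iSup_rayleighQuotient hx.isSymmetric]
  refine ciSup_le fun v ↦ ?_
  rcases eq_or_ne v 0 with rfl | hv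
  · simpa using hc
  have hv' : ‖v‖ ≠ 0 := norm_ne_zero_iff.2 hv
  have hu : ‖((‖v‖⁻¹ : ℝ) : ℂ) • v‖ = 1 := by simp [norm_smul, hv']
  rw [← x.rayleigh_smul v (c := ((‖v‖⁻¹ : ℝ) : ℂ)) (by simpa using hv)]
  have := h _ hu.le
  rw [← inner_conj_symm, Complex.conj_re] at this
  rwa [ContinuousLinearMap.rayleighQuotient, hu, one_pow, div_one]

/-- If a set of self-adjoint operators has weakly closed bounded parts and avoids a ball around the
origin, then countably many vector functionals tending to zero in norm suffice to
separate each of its points from the origin. -/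
theorem exists_vector_constraints {C : Set (H →L[ℂ] H)} (hsa : ∀ x ∈ C, IsSelfAdjoint x)
    (hcl : ∀ r, IsClosed (ContinuousLinearMapWOT.toCLM ⁻¹' (C ∩ Metric.closedBall 0 r)))
    {ε : ℝ} (hε : 0 < ε) (hC : ∀ x ∈ C, ε < ‖x‖) :
    ∃ I : Set (H × ℝ), (∀ p ∈ I, ‖p.1‖ ≤ 1 ∧ ε ≤ p.2) ∧ (∀ R, {p ∈ I | p.2 < R}.Finite) ∧
      ∀ x ∈ C, ∃ p ∈ I, p.2 < |(⟪p.1, x p.1⟫_ℂ).re| := by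
  classical
  let r : ℕ → ℝ := fun n ↦ ε * (n + 1)
  have hr_mono : StrictMono r := fun m n h ↦ by simpa [r, hε] using h
  -- A pair (ξ, c) stands for the constraint |⟪ξ, x ξ⟫| ≤ c. The invariant says that every point of
  -- C of norm at most `r n` violates some constraint in T.
  let inv : ℕ → Finset (H × ℝ) → Prop := fun n T ↦
    ∀ x ∈ C, ‖x‖ ≤ r n → ∃ p ∈ T, p.2 < |(⟪p.1, x p.1⟫_ℂ).re|
  have hcont (ξ : H) : Continuous fun y : H →WOT[ℂ] H ↦ |(⟪ξ, y ξ⟫_ℂ).re| :=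
    (Complex.continuous_re.comp
      (ContinuousLinearMapWOT.continuous_dual_apply ξ (innerSL ℂ ξ))).abs
  have step (n : ℕ) (T : Finset (H × ℝ)) (hT : inv n T) : ∃ T', inv (n + 1) T' ∧ T ⊆ T' ∧
      ∀ p ∈ T', p ∉ T → ‖p.1‖ ≤ 1 ∧ p.2 = r n := by
    -- By the invariant, points of K have norm above `r n`, so each violates a quadratic-form
    -- constraint at level `r n`. Compactness of K leaves finitely many of these to add.
    let K : Set (H →WOT[ℂ] H) :=
      ContinuousLinearMapWOT.toCLM ⁻¹' (C ∩ Metric.closedBall 0 (r (n + 1))) ∩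
        ⋂ p ∈ T, {y | |(⟪p.1, y p.1⟫_ℂ).re| ≤ p.2}
    have hK : IsCompact K := by
      refine (ContinuousLinearMapWOT.isCompact_preimage_closedBall (r (n + 1))).of_isClosed_subset
        ((hcl _).inter ?_) fun y hy ↦ hy.1.2
      exact isClosed_biInter fun p _ ↦ isClosed_le (hcont _) continuous_const
    obtain ⟨u, hu⟩ := hK.elim_finite_subfamily_closed
      (fun ξ : Metric.closedBall (0 : H) 1 ↦ {y | |(⟪(ξ : H), y (ξ : H)⟫_ℂ).re| ≤ r n})
      (fun ξ ↦ isClosed_le (hcont _) continuous_const) (by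
        rw [Set.eq_empty_iff_forall_notMem]
        rintro y ⟨⟨⟨hyC, -⟩, hyT⟩, hy⟩
        have hyn : ‖y.toCLM‖ ≤ r n := by
          refine (hsa _ hyC).norm_le_of_abs_re_inner_le (by positivity) fun ξ hξ ↦ ?_
          exact Set.mem_iInter.1 hy ⟨ξ, mem_closedBall_zero_iff.2 hξ⟩
        obtain ⟨p, hp, hlt⟩ := hT _ hyC hyn
        exact absurd hlt (Set.mem_iInter₂.1 hyT p hp).not_gt)
    refine ⟨T ∪ u.image fun ξ : Metric.closedBall (0 : H) 1 ↦ ((ξ : H), r n), fun x hxC hx ↦ ?_, Finset.subset_union_left, ?_⟩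
    · by_contra! hcon
      refine Set.eq_empty_iff_forall_notMem.1 hu (ContinuousLinearMapWOT.ofCLM x)
        ⟨⟨⟨hxC, mem_closedBall_zero_iff.2 hx⟩, Set.mem_iInter₂.2 fun p hp ↦ ?_⟩,
          Set.mem_iInter₂.2 fun ξ hξ ↦ ?_⟩
      · exact hcon p (Finset.mem_union_left _ hp)
      · exact hcon ((ξ : H), r n) (Finset.mem_union_right _ (Finset.mem_image_of_mem _ hξ))
    · intro p hp hpT
      obtain ⟨ξ, -, rfl⟩ := Finset.mem_image.1 ((Finset.mem_union.1 hp).resolve_left hpT)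
      exact ⟨mem_closedBall_zero_iff.1 ξ.2, rfl⟩
  choose next hnext hsub hnew using step
  -- The empty set works at stage 0, since `r 0 = ε` and C avoids the ball of radius ε.
  let S : ∀ n, {T : Finset (H × ℝ) // inv n T} := fun n ↦ Nat.rec
    ⟨∅, fun x hx hxn ↦ absurd (hC x hx) (by simpa [r] using hxn)⟩
    (fun n T ↦ ⟨next n T.1 T.2, hnext n T.1 T.2⟩) n
  have hS_mono : Monotone fun n ↦ (S n).1 :=
    monotone_nat_of_le_succ fun n ↦ hsub n (S n).1 (S n).2
  -- The threshold of a constraint records the stage at which it entered; hence only finitely many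
  -- thresholds lie below a given R.
  have hS_new (n : ℕ) (p : H × ℝ) (hp : p ∈ (S n).1) : ∃ m < n, ‖p.1‖ ≤ 1 ∧ p.2 = r m ∧
      p ∈ (S (m + 1)).1 := by
    induction n with
    | zero => exact absurd hp (Finset.notMem_empty p)
    | succ n ih =>
      by_cases hpn : p ∈ (S n).1
      · obtain ⟨m, hm, h⟩ := ih hpn
        exact ⟨m, hm.trans n.lt_succ_self, h⟩
      · obtain ⟨h1, h2⟩ := hnew n (S n).1 (S n).2 p hp hpn
        exact ⟨n, n.lt_succ_self, h1, h2, hp⟩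
  refine ⟨⋃ n, ((S n).1 : Set (H × ℝ)), fun p hp ↦ ?_, fun R ↦ ?_, fun x hx ↦ ?_⟩
  · obtain ⟨n, hn⟩ := Set.mem_iUnion.1 hp
    obtain ⟨m, -, h1, h2, -⟩ := hS_new n p hn
    refine ⟨h1, h2 ▸ ?_⟩
    have : (0 : ℝ) ≤ m := m.cast_nonneg
    simp only [r]
    nlinarith
  · obtain ⟨N, hN⟩ := exists_nat_gt (R / ε)
    refine (S N).1.finite_toSet.subset ?_
    rintro p ⟨hp, hpR⟩
    obtain ⟨n, hn⟩ := Set.mem_iUnion.1 hp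
    obtain ⟨m, -, -, h2, h3⟩ := hS_new n p hn
    refine hS_mono (show m + 1 ≤ N from ?_) h3
    by_contra! hcon
    have h4 : (N : ℝ) ≤ m := by exact_mod_cast Nat.lt_succ_iff.1 hcon
    rw [div_lt_iff₀ hε] at hN
    simp only [h2, r] at hpR
    nlinarith
  · obtain ⟨n, hn⟩ := exists_nat_gt (‖x‖ / ε)
    obtain ⟨p, hp, hlt⟩ := (S n).2 x hx (by
      rw [div_lt_iff₀ hε] at hn
      simp only [r]
      nlinarith)
    exact ⟨p, Set.mem_iUnion.2 ⟨n, hp⟩, hlt⟩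

/-- **Krein–Smulian theorem** for self-adjoint operators: a norm closed convex set of self-adjoint
operators not containing the origin whose bounded parts are weakly closed is separated from the
origin by a normal functional. -/
theorem Convex.exists_normal_separation {C : Set (H →L[ℂ] H)} (hC : Convex ℝ C)
    (hsa : ∀ x ∈ C, IsSelfAdjoint x) (hclosed : IsClosed C)
    (hcl : ∀ r, IsClosed (ContinuousLinearMapWOT.toCLM ⁻¹' (C ∩ Metric.closedBall 0 r)))
    (h0 : (0 : H →L[ℂ] H) ∉ C) :
    ∃ ξ η : lp (fun _ : ℕ ↦ H) 2,
      (∀ x : H →L[ℂ] H, IsSelfAdjoint x → (∑' n, ⟪ξ n, x (η n)⟫_ℂ).im = 0) ∧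
      ∃ δ > 0, ∀ x ∈ C, δ ≤ (∑' n, ⟪ξ n, x (η n)⟫_ℂ).re := by
  obtain ⟨ε, hε, hball⟩ := Metric.nhds_basis_closedBall.mem_iff.1 (hclosed.isOpen_compl.mem_nhds h0)
  obtain ⟨I, hI, hfin, hIC⟩ := exists_vector_constraints hsa hcl hε fun x hx ↦ by
    by_contra! hcon
    exact hball (mem_closedBall_zero_iff.2 hcon) hx
  have hcount : I.Countable := by
    refine (Set.countable_iUnion fun n : ℕ ↦ (hfin n).countable).mono fun p hp ↦ ?_
    obtain ⟨n, hn⟩ := exists_nat_gt p.2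
    exact Set.mem_iUnion.2 ⟨n, hp, hn⟩
  have := hcount.to_subtype
  have hpos (p : I) : 0 < p.1.2 := hε.trans_le (hI _ p.2).2
  -- Dividing by the thresholds, which tend to infinity, gives a pointwise null family, and every
  -- point of C makes some member exceed 1 in absolute value.
  let g : I → (H →L[ℂ] H) →ₗ[ℝ] ℝ := fun p ↦
    { toFun := fun x ↦ p.1.2⁻¹ * (⟪p.1.1, x p.1.1⟫_ℂ).re
      map_add' := fun x y ↦ by simp [mul_add]
      map_smul' := fun c x ↦ by
        have : (c • x) p.1.1 = (c : ℂ) • x p.1.1 := by simp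
        rw [this, inner_smul_right, Complex.re_ofReal_mul, RingHom.id_apply, smul_eq_mul]
        ring }
  have hg (x : H →L[ℂ] H) : Tendsto (fun p ↦ g p x) cofinite (𝓝 0) := by
    have hlim : Tendsto (fun p : I ↦ p.1.2) cofinite atTop := by
      refine tendsto_atTop.2 fun R ↦ ?_
      rw [eventually_cofinite]
      refine Set.Finite.of_finite_image ((hfin R).subset ?_) Subtype.val_injective.injOn
      rintro - ⟨p, hp, rfl⟩
      exact ⟨p.2, not_le.1 hp⟩
    have hlim' := hlim.inv_tendsto_atTop.mul_const ‖x‖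
    rw [zero_mul] at hlim'
    refine squeeze_zero_norm (fun p ↦ ?_) hlim'
    have h1 : ‖p.1.1‖ ≤ 1 := (hI _ p.2).1
    simp only [g, LinearMap.coe_mk, AddHom.coe_mk, norm_mul, norm_inv, Pi.inv_apply,
      Real.norm_of_nonneg (hpos p).le]
    refine mul_le_mul_of_nonneg_left ?_ (inv_nonneg.2 (hpos p).le)
    calc ‖(⟪p.1.1, x p.1.1⟫_ℂ).re‖ ≤ ‖⟪p.1.1, x p.1.1⟫_ℂ‖ := Complex.abs_re_le_norm _
      _ ≤ ‖p.1.1‖ * (‖x‖ * ‖p.1.1‖) := (norm_inner_le_norm _ _).trans <| by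
        gcongr; exact x.le_opNorm _
      _ ≤ 1 * (‖x‖ * 1) := by gcongr
      _ = ‖x‖ := by ring
  obtain ⟨a, ha, δ, hδ, haδ⟩ := hC.exists_summable_le_tsum g hg fun x hx ↦ by
    obtain ⟨p, hp, hlt⟩ := hIC x hx
    refine ⟨⟨p, hp⟩, ?_⟩
    have := hpos ⟨p, hp⟩
    simp only [g, LinearMap.coe_mk, AddHom.coe_mk, abs_mul, abs_inv, abs_of_pos this]
    rwa [inv_mul_eq_div, one_lt_div this]
  have hb : Summable fun p : I ↦ |a p * p.1.2⁻¹| := by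
    refine (ha.mul_right ε⁻¹).of_nonneg_of_le (fun _ ↦ abs_nonneg _) fun p ↦ ?_
    rw [abs_mul, abs_inv, abs_of_pos (hpos p)]
    gcongr
    exact (hI _ p.2).2
  obtain ⟨ξ, η, h⟩ := exists_lp_tsum_inner_eq hb (v := fun p : I ↦ p.1.1) fun p ↦ (hI _ p.2).1
  have hreal (x : H →L[ℂ] H) (hx : IsSelfAdjoint x) :
      ∑' n, ⟪ξ n, x (η n)⟫_ℂ = ((∑' p, a p * g p x : ℝ) : ℂ) := by
    rw [h, Complex.ofReal_tsum]
    refine tsum_congr fun p ↦ ?_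
    have : ((⟪p.1.1, x p.1.1⟫_ℂ).re : ℂ) = ⟪p.1.1, x p.1.1⟫_ℂ := by
      rw [← Complex.conj_eq_iff_re, inner_conj_symm]
      exact hx.isSymmetric _ _
    simp only [g, LinearMap.coe_mk, AddHom.coe_mk]
    push_cast
    rw [this]
    ring
  refine ⟨ξ, η, fun x hx ↦ by rw [hreal x hx, Complex.ofReal_im], δ, hδ, fun x hx ↦ ?_⟩
  rw [hreal x (hsa x hx), Complex.ofReal_re]
  exact haδ x hx

end KreinSmulian

/-! ### Order, norm and continuity properties of the Yosida approximation. -/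

section Yosida

variable {H : Type*} [NormedAddCommGroup H] [InnerProductSpace ℂ H]

/-- The Yosida approximation `α⁻¹ (1 - (1 + α x)⁻¹) = x (1 + α x)⁻¹` of an operator `x`. -/
noncomputable def yosida (α : ℝ) (x : H →L[ℂ] H) : H →L[ℂ] H :=
  α⁻¹ • (1 - Ring.inverse (1 + α • x))

variable {α : ℝ} {x y : H →L[ℂ] H}

theorem sub_yosida (hα : α ≠ 0) (hx : IsUnit (1 + α • x)) :
    x - yosida α x = α • (x * Ring.inverse (1 + α • x) * x) := by
  set b := 1 + α • x with hb
  have hxb : x = α⁻¹ • (b - 1) := by simp [hb, smul_smul, hα]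
  have h1 : b * Ring.inverse b = 1 := Ring.mul_inverse_cancel b hx
  have h2 : Ring.inverse b * b = 1 := Ring.inverse_mul_cancel b hx
  rw [yosida, ← hb, hxb]
  simp only [smul_mul_assoc, mul_smul_comm, smul_smul, sub_mul, mul_sub, h1, h2, one_mul, mul_one,
    mul_inv_cancel_left₀ hα, smul_sub]

variable [CompleteSpace H]

theorem isStrictlyPositive_one_add_smul_of_nonneg (hα : 0 ≤ α) (hx : 0 ≤ x) :
    IsStrictlyPositive (1 + α • x) := by
  have h : (1 : H →L[ℂ] H) ≤ 1 + α • x := le_add_of_nonneg_right (smul_nonneg hα hx)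
  exact ⟨zero_le_one.trans h, CStarAlgebra.isUnit_of_le 1 h⟩

theorem isUnit_one_add_smul (hα : 0 ≤ α) (hx : α * ‖x‖ ≤ 1 / 2) : IsUnit (1 + α • x) := by
  have : ‖-(α • x)‖ < 1 := by
    rw [norm_neg, norm_smul, Real.norm_of_nonneg hα]
    linarith
  simpa using isUnit_one_sub_of_norm_lt_one this

theorem IsSelfAdjoint.isStrictlyPositive_one_add_smul (hx : IsSelfAdjoint x) (hα : 0 ≤ α)
    (hαx : α * ‖x‖ ≤ 1 / 2) : IsStrictlyPositive (1 + α • x) := by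
  refine ⟨?_, isUnit_one_add_smul hα hαx⟩
  have h1 : -algebraMap ℝ (H →L[ℂ] H) ‖x‖ ≤ x := hx.neg_algebraMap_norm_le_self
  have h2 : 0 ≤ algebraMap ℝ (H →L[ℂ] H) (1 - α * ‖x‖) := algebraMap_nonneg _ (by linarith)
  have h3 : algebraMap ℝ (H →L[ℂ] H) (1 - α * ‖x‖) =
      1 + α • -algebraMap ℝ (H →L[ℂ] H) ‖x‖ := by
    rw [map_sub, map_one, map_mul, smul_neg, ← Algebra.smul_def, sub_eq_add_neg]
  calc 0 ≤ 1 + α • -algebraMap ℝ (H →L[ℂ] H) ‖x‖ := h3 ▸ h2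
    _ ≤ 1 + α • x := by gcongr

/-- Inversion reverses the order on strictly positive operators. Here x need not be positive: strict
positivity of 1 + αx suffices. -/
theorem yosida_le_yosida (hα : 0 ≤ α) (hx : IsStrictlyPositive (1 + α • x)) (hxy : x ≤ y) :
    yosida α x ≤ yosida α y := by
  refine smul_le_smul_of_nonneg_left (sub_le_sub_left ?_ 1) (inv_nonneg.2 hα)
  refine CStarAlgebra.ringInverse_le_ringInverse ?_ hx
  gcongr

theorem yosida_le (hα : 0 < α) (hx : 0 ≤ x) : yosida α x ≤ x := by
  have hb := isStrictlyPositive_one_add_smul_of_nonneg hα.le hx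
  rw [← sub_nonneg, sub_yosida hα.ne' hb.isUnit]
  exact smul_nonneg hα.le (conjugate_nonneg_of_nonneg hb.ringInverse.nonneg hx)

theorem yosida_nonneg (hα : 0 ≤ α) (hx : 0 ≤ x) : 0 ≤ yosida α x := by
  have h := yosida_le_yosida (x := 0) hα (by simp) hx
  simpa [yosida] using h

theorem norm_yosida_le (hα : 0 < α) (hx : 0 ≤ x) : ‖yosida α x‖ ≤ α⁻¹ := by
  have hb := isStrictlyPositive_one_add_smul_of_nonneg hα.le hx
  rw [CStarAlgebra.norm_le_iff_le_algebraMap _ (inv_nonneg.2 hα.le) (yosida_nonneg hα.le hx),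
    Algebra.algebraMap_eq_smul_one, yosida]
  exact smul_le_smul_of_nonneg_left (sub_le_self _ hb.ringInverse.nonneg) (inv_nonneg.2 hα.le)

theorem norm_ringInverse_one_add_smul_le (hα : 0 ≤ α) (hx : α * ‖x‖ ≤ 1 / 2) :
    ‖Ring.inverse (1 + α • x)‖ ≤ 2 := by
  set b := 1 + α • x with hb
  have h : Ring.inverse b = 1 - Ring.inverse b * α • x := by
    have := Ring.inverse_mul_cancel b (isUnit_one_add_smul hα hx)
    rw [hb, mul_add, mul_one, ← hb] at this
    exact eq_sub_of_add_eq this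
  have h1 : ‖Ring.inverse b‖ ≤ 1 + ‖Ring.inverse b‖ * (1 / 2) := by
    calc ‖Ring.inverse b‖ = ‖1 - Ring.inverse b * α • x‖ := congrArg _ h
      _ ≤ ‖(1 : H →L[ℂ] H)‖ + ‖Ring.inverse b * α • x‖ := norm_sub_le _ _
      _ ≤ 1 + ‖Ring.inverse b‖ * (α * ‖x‖) := by
        gcongr
        · exact ContinuousLinearMap.norm_id_le
        · refine (norm_mul_le _ _).trans_eq ?_
          rw [norm_smul, Real.norm_of_nonneg hα]
      _ ≤ _ := by gcongr
  linarith

theorem norm_sub_yosida_le (hα : 0 < α) (hx : α * ‖x‖ ≤ 1 / 2) :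
    ‖x - yosida α x‖ ≤ α * (‖x‖ * 2 * ‖x‖) := by
  rw [sub_yosida hα.ne' (isUnit_one_add_smul hα.le hx), norm_smul, Real.norm_of_nonneg hα.le]
  gcongr
  refine (norm_mul_le _ _).trans ?_
  gcongr
  refine (norm_mul_le _ _).trans ?_
  gcongr
  exact norm_ringInverse_one_add_smul_le hα.le hx

theorem tendsto_yosida_zero (x : H →L[ℂ] H) :
    Tendsto (fun α ↦ yosida α x) (𝓝[>] 0) (𝓝 x) := by
  have h1 : Tendsto (fun α : ℝ ↦ α * (‖x‖ * 2 * ‖x‖)) (𝓝[>] 0) (𝓝 0) :=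
    (Continuous.tendsto' (by fun_prop) 0 0 (by simp)).mono_left nhdsWithin_le_nhds
  have h2 : Tendsto (fun α : ℝ ↦ α * ‖x‖) (𝓝[>] 0) (𝓝 0) :=
    (Continuous.tendsto' (by fun_prop) 0 0 (by simp)).mono_left nhdsWithin_le_nhds
  rw [tendsto_iff_norm_sub_tendsto_zero]
  refine squeeze_zero' (Eventually.of_forall fun _ ↦ norm_nonneg _) ?_ h1
  filter_upwards [self_mem_nhdsWithin, h2.eventually_le_const (show (0 : ℝ) < 1 / 2 by norm_num)]
    with α hα hαx
  rw [norm_sub_rev]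
  exact norm_sub_yosida_le hα hαx

theorem norm_yosida_sub_yosida_apply_le (hα : 0 < α) (hx : α * ‖x‖ ≤ 1 / 2)
    (hy : α * ‖y‖ ≤ 1 / 2) (ξ : H) :
    ‖yosida α y ξ - yosida α x ξ‖ ≤
      2 * ‖y (Ring.inverse (1 + α • x) ξ) - x (Ring.inverse (1 + α • x) ξ)‖ := by
  have h1 := Ring.mul_inverse_cancel _ (isUnit_one_add_smul hα.le hx)
  have h2 := Ring.inverse_mul_cancel _ (isUnit_one_add_smul hα.le hy)
  -- Resolvent identity. The right-hand factor involves only x, so strong convergence of y to x can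
  -- be tested at one fixed vector.
  have h3 : yosida α y - yosida α x =
      Ring.inverse (1 + α • y) * (y - x) * Ring.inverse (1 + α • x) := by
    have h4 : y - x = α⁻¹ • ((1 + α • y) - (1 + α • x)) := by
      rw [add_sub_add_left_eq_sub, ← smul_sub, smul_smul, inv_mul_cancel₀ hα.ne', one_smul]
    rw [yosida, yosida, h4, mul_smul_comm, smul_mul_assoc, mul_sub, sub_mul, h2, one_mul,
      mul_assoc, h1, mul_one, ← smul_sub, sub_sub_sub_cancel_left]
  rw [← sub_apply, h3, ← sub_apply]
  exact ContinuousLinearMap.le_of_opNorm_le _ (norm_ringInverse_one_add_smul_le hα.le hy) _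

/-- The Yosida approximation is continuous for the strong operator topology on bounded sets. -/
theorem tendsto_yosida_apply {ι : Type*} {l : Filter ι} {c : ι → H →L[ℂ] H} (hα : 0 < α)
    (hx : α * ‖x‖ ≤ 1 / 2) (hc : ∀ᶠ i in l, α * ‖c i‖ ≤ 1 / 2)
    (h : ∀ ξ, Tendsto (fun i ↦ c i ξ) l (𝓝 (x ξ))) (ξ : H) :
    Tendsto (fun i ↦ yosida α (c i) ξ) l (𝓝 (yosida α x ξ)) := by
  rw [tendsto_iff_norm_sub_tendsto_zero]
  have h1 := (tendsto_iff_norm_sub_tendsto_zero.1 (h (Ring.inverse (1 + α • x) ξ))).const_mul 2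
  rw [mul_zero] at h1
  refine squeeze_zero' (Eventually.of_forall fun _ ↦ norm_nonneg _) ?_ h1
  filter_upwards [hc] with i hi
  exact norm_yosida_sub_yosida_apply_le hα hx hi ξ

/-- By the bicommutant property: whatever commutes with an invertible operator commutes with its
inverse. For a non-unit `Ring.inverse` is 0, which commutes with everything. -/
theorem VonNeumannAlgebra.yosida_mem (M : VonNeumannAlgebra H) (α : ℝ) (hx : x ∈ M) :
    yosida α x ∈ M := by
  have real_smul_mem (c : ℝ) {z : H →L[ℂ] H} (hz : z ∈ M) : c • z ∈ M :=
    (c • (⟨z, hz⟩ : M)).2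
  refine real_smul_mem _ (sub_mem (one_mem M) ?_)
  have hb : 1 + α • x ∈ M := add_mem (one_mem M) (real_smul_mem _ hx)
  rw [← SetLike.mem_coe, ← M.centralizer_centralizer, Set.mem_centralizer_iff] at hb ⊢
  intro g hg
  by_cases hu : IsUnit (1 + α • x)
  · obtain ⟨u, hu⟩ := hu
    rw [← hu] at hb ⊢
    rw [Ring.inverse_unit]
    exact Commute.units_inv_right (hb g hg)
  · simp [Ring.inverse_non_unit _ hu]

end Yosida

open ContinuousLinearMapWOT

/-! ### Weakly closed sets and strongly convergent nets. -/

section WeakOperatorTopology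

variable {H : Type*} [NormedAddCommGroup H] [InnerProductSpace ℂ H]

theorem lp.summable_norm_mul_norm {H : Type*} [NormedAddCommGroup H]
    (ξ η : lp (fun _ : ℕ ↦ H) 2) :
    Summable fun n ↦ ‖ξ n‖ * ‖η n‖ := by
  have h (ζ : lp (fun _ : ℕ ↦ H) 2) : Summable fun n ↦ ‖ζ n‖ ^ 2 := by
    simpa using (lp.memℓp ζ).summable (by simp)
  refine ((h ξ).add (h η)).of_nonneg_of_le (fun n ↦ by positivity) fun n ↦ ?_
  nlinarith [sq_nonneg (‖ξ n‖ - ‖η n‖), sq_nonneg ‖ξ n‖, sq_nonneg ‖η n‖]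

theorem ContinuousLinearMap.norm_inner_apply_le (x : H →L[ℂ] H) (ξ η : H) :
    ‖⟪ξ, x η⟫_ℂ‖ ≤ ‖x‖ * (‖ξ‖ * ‖η‖) :=
  calc ‖⟪ξ, x η⟫_ℂ‖ ≤ ‖ξ‖ * (‖x‖ * ‖η‖) :=
        (norm_inner_le_norm _ _).trans (by gcongr; exact x.le_opNorm η)
    _ = ‖x‖ * (‖ξ‖ * ‖η‖) := by ring

theorem ContinuousLinearMap.summable_inner_apply (x : H →L[ℂ] H) (ξ η : lp (fun _ : ℕ ↦ H) 2) :
    Summable fun n ↦ ⟪ξ n, x (η n)⟫_ℂ :=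
  ((lp.summable_norm_mul_norm ξ η).mul_left ‖x‖).of_norm_bounded fun _ ↦ ContinuousLinearMap.norm_inner_apply_le _ _ _

theorem ContinuousLinearMapWOT.isClosed_nonneg :
    IsClosed {x : H →WOT[ℂ] H | 0 ≤ x.toCLM} := by
  have : {x : H →WOT[ℂ] H | 0 ≤ x.toCLM} = ⋂ ξ : H, {x | 0 ≤ ⟪ξ, x ξ⟫_ℂ} := by
    ext x
    simp only [ContinuousLinearMap.nonneg_iff_isPositive, Set.mem_ofPred_eq, Set.mem_iInter]
    refine ⟨fun h ξ ↦ h.inner_nonneg_right ξ, fun h ↦ ?_⟩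
    refine (ContinuousLinearMap.isPositive_iff_complex _).2 fun ξ ↦ ?_
    have h1 := h ξ
    rw [← inner_conj_symm, Complex.nonneg_iff, Complex.conj_re, Complex.conj_im] at h1
    exact ⟨Complex.ext rfl (by simpa [eq_comm] using h1.2), h1.1⟩
  rw [this]
  refine isClosed_iInter fun ξ ↦ ?_
  have hcont : Continuous fun x : H →WOT[ℂ] H ↦ ⟪ξ, x ξ⟫_ℂ :=
    continuous_dual_apply ξ (innerSL ℂ ξ)
  simp only [Complex.nonneg_iff]
  exact (isClosed_le continuous_const (Complex.continuous_re.comp hcont)).inter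
    (isClosed_eq continuous_const (Complex.continuous_im.comp hcont))

variable [CompleteSpace H]

theorem ContinuousLinearMapWOT.isClosed_preimage_closedBall (r : ℝ) :
    IsClosed (toCLM ⁻¹' Metric.closedBall 0 r : Set (H →WOT[ℂ] H)) :=
  (isCompact_preimage_closedBall r).isClosed

/-- Strong convergence implies weak convergence. -/
theorem ContinuousLinearMapWOT.tendsto_ofCLM_of_tendsto_apply {ι : Type*} {l : Filter ι}
    {c : ι → H →L[ℂ] H} {x : H →L[ℂ] H} (h : ∀ ξ, Tendsto (fun i ↦ c i ξ) l (𝓝 (x ξ))) :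
    Tendsto (fun i ↦ ofCLM (c i)) l (𝓝 (ofCLM x)) := by
  rw [tendsto_iff_forall_inner_apply_tendsto]
  exact fun ξ η ↦ tendsto_const_nhds.inner (h ξ)

/-- A weak limit of points of a convex set of operators is the strong limit of a net in this set. -/
theorem Convex.exists_tendsto_apply_of_mem_closure_wot {S : Set (H →L[ℂ] H)}
    (hS : Convex ℝ S) {x : H →L[ℂ] H} (hx : ofCLM x ∈ closure (toCLM ⁻¹' S)) :
    ∃ c : Finset H × ℕ → H →L[ℂ] H, (∀ i, c i ∈ S) ∧
      ∀ ξ, Tendsto (fun i ↦ c i ξ) atTop (𝓝 (x ξ)) := by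
  choose c hcS hc using fun i : Finset H × ℕ ↦
    hS.exists_norm_apply_sub_lt_of_mem_closure_wot hx i.1 (Nat.one_div_pos_of_nat (n := i.2))
  refine ⟨c, hcS, fun ξ ↦ ?_⟩
  rw [tendsto_iff_norm_sub_tendsto_zero]
  have h1 : Tendsto (fun i : Finset H × ℕ ↦ 1 / ((i.2 : ℝ) + 1)) atTop (𝓝 0) :=
    tendsto_one_div_add_atTop_nhds_zero_nat.comp <| by
      rw [← prod_atTop_atTop_eq]
      exact tendsto_snd
  refine squeeze_zero' (Eventually.of_forall fun _ ↦ norm_nonneg _) ?_ h1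
  filter_upwards [eventually_ge_atTop (({ξ} : Finset H), 0)] with i hi
  exact (hc i ξ (hi.1 (Finset.mem_singleton_self ξ))).le

end WeakOperatorTopology

/-! ### The set F - M^+ and its norm closure. -/

namespace VonNeumannAlgebra

variable {H : Type*} [NormedAddCommGroup H] [InnerProductSpace ℂ H] [CompleteSpace H]
  {M : VonNeumannAlgebra H}

/-- M is its own bicommutant, and commutation with a fixed operator is a weakly closed condition,
tested on pairs of vectors. -/
theorem isClosed_wot (M : VonNeumannAlgebra H) :
    IsClosed (toCLM ⁻¹' (M : Set (H →L[ℂ] H))) := by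
  have : (toCLM ⁻¹' (M : Set (H →L[ℂ] H))) =
      ⋂ g ∈ Set.centralizer (M : Set (H →L[ℂ] H)), ⋂ ξ : H, ⋂ η : H,
        {x : H →WOT[ℂ] H | ⟪ContinuousLinearMap.adjoint g η, x ξ⟫_ℂ = ⟪η, x (g ξ)⟫_ℂ} := by
    ext x
    rw [Set.mem_preimage]
    conv_lhs => rw [← M.centralizer_centralizer]
    simp only [Set.mem_iInter, Set.mem_ofPred_eq,
      Set.mem_centralizer_iff (S := Set.centralizer (M : Set (H →L[ℂ] H))), ContinuousLinearMap.adjoint_inner_left]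
    refine forall₂_congr fun g _ ↦ ⟨fun h ↦ ?_, fun h ↦ ?_⟩
    · exact fun ξ η ↦ congrArg (fun T : H →L[ℂ] H ↦ ⟪η, T ξ⟫_ℂ) h
    · ext ξ
      exact ext_inner_left ℂ fun η ↦ h ξ η
  rw [this]
  exact isClosed_biInter fun g _ ↦ isClosed_iInter fun ξ ↦ isClosed_iInter fun η ↦
    isClosed_eq (continuous_dual_apply ξ (innerSL ℂ _)) (continuous_dual_apply _ (innerSL ℂ η))

/-- The normal functional `x ↦ ∑ₙ ⟪ξₙ, x ηₙ⟫`. -/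
noncomputable def vectorFunctional (M : VonNeumannAlgebra H) (ξ η : lp (fun _ : ℕ ↦ H) 2) :
    M.predual :=
  ⟨{ toFun := fun x ↦ ∑' n, ⟪ξ n, (x : H →L[ℂ] H) (η n)⟫_ℂ
     map_add' := fun x y ↦ by
       rw [← (ContinuousLinearMap.summable_inner_apply x.1 ξ η).tsum_add (ContinuousLinearMap.summable_inner_apply y.1 ξ η)]
       exact tsum_congr fun n ↦ inner_add_right _ _ _
     map_smul' := fun c x ↦ by
       rw [RingHom.id_apply, smul_eq_mul, ← tsum_mul_left]
       exact tsum_congr fun n ↦ inner_smul_right _ _ _ },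
    continuous_iInf_dom (i := ξ) (continuous_iInf_dom (i := η) continuous_induced_dom)⟩

/-- On bounded sets, weak operator convergence implies `σ`-weak convergence. -/
theorem tendsto_sigmaWeak {ι : Type*} {l : Filter ι} {c : ι → M} {x : M} {r : ℝ}
    (hr : ∀ᶠ i in l, ‖(c i : H →L[ℂ] H)‖ ≤ r)
    (h : Tendsto (fun i ↦ ofCLM (c i : H →L[ℂ] H)) l (𝓝 (ofCLM (x : H →L[ℂ] H)))) :
    Tendsto c l (@nhds _ M.sigmaWeak x) := by
  simp only [nhds_iInf, tendsto_iInf, nhds_induced, tendsto_comap_iff]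
  intro ξ η
  refine tendsto_tsum_of_dominated_convergence ((lp.summable_norm_mul_norm ξ η).mul_left r)
    (fun n ↦ ?_) ?_
  · exact tendsto_iff_forall_inner_apply_tendsto.1 h (η n) (ξ n)
  · filter_upwards [hr] with i hi n
    exact (ContinuousLinearMap.norm_inner_apply_le _ _ _).trans (by gcongr)

variable {F : Set M}

/-- The bounded parts of a `σ`-weakly closed subset of `M` are closed in the weak operator
topology. -/
theorem isClosed_wot_of_isClosed_sigmaWeak (hF : IsClosed[M.sigmaWeak] F) (r : ℝ) :
    IsClosed (toCLM ⁻¹' ((↑) '' F ∩ Metric.closedBall (0 : H →L[ℂ] H) r)) := by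
  rw [isClosed_iff_ultrafilter]
  intro x u hux hu
  have hM : x.toCLM ∈ M := isClosed_iff_ultrafilter.1 M.isClosed_wot x u hux <|
    mem_of_superset hu fun y hy ↦ by
      obtain ⟨⟨z, -, hz⟩, -⟩ := hy
      exact (hz ▸ z.2 : y.toCLM ∈ M)
  refine ⟨⟨⟨x.toCLM, hM⟩, ?_, rfl⟩, isClosed_iff_ultrafilter.1
    (isClosed_preimage_closedBall r) x u hux (mem_of_superset hu fun y hy ↦ hy.2)⟩
  classical
  -- The default value 0 is irrelevant: the ultrafilter lives on operators in the image of F.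
  let c : (H →WOT[ℂ] H) → M := fun y ↦ if h : y.toCLM ∈ M then ⟨y.toCLM, h⟩ else 0
  have hc : ∀ᶠ y in (u : Filter (H →WOT[ℂ] H)),
      c y ∈ F ∧ ‖y.toCLM‖ ≤ r ∧ (c y : H →L[ℂ] H) = y.toCLM := by
    filter_upwards [hu] with y hy
    obtain ⟨⟨z, hz, hzy⟩, hyr⟩ := hy
    have hyM : y.toCLM ∈ M := hzy ▸ z.2
    have hcz : c y = z := Subtype.ext (by simp [c, hyM, hzy])
    exact ⟨hcz ▸ hz, mem_closedBall_zero_iff.1 hyr, by rw [hcz, hzy]⟩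
  have hlim : Tendsto c u (@nhds _ M.sigmaWeak ⟨x.toCLM, hM⟩) := by
    refine tendsto_sigmaWeak (r := r) ?_ ?_
    · filter_upwards [hc] with y hy
      exact hy.2.2 ▸ hy.2.1
    · refine Tendsto.congr' ?_ (show Tendsto id _ _ from hux)
      filter_upwards [hc] with y hy
      rw [hy.2.2]
      rfl
  let _ := M.sigmaWeak
  exact hF.mem_of_tendsto hlim (hc.mono fun y hy ↦ hy.1)

/-- The elements of `M` which are dominated by an element of `F` of norm at most `r`. -/
def boundedLowerSet (F : Set M) (r : ℝ) : Set (H →L[ℂ] H) :=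
  {x | x ∈ M ∧ ∃ y ∈ F, ‖(y : H →L[ℂ] H)‖ ≤ r ∧ x ≤ y}

/-- The elements of `M` which are dominated by an element of `F`. -/
def dominatedSet (F : Set M) : Set (H →L[ℂ] H) :=
  {x | x ∈ M ∧ ∃ y ∈ F, x ≤ y}

theorem boundedLowerSet_subset (r : ℝ) : boundedLowerSet F r ⊆ dominatedSet F :=
  fun _ ⟨hx, y, hy, _, hxy⟩ ↦ ⟨hx, y, hy, hxy⟩

/-- The set is M ∩ (K + N), with K = F ∩ ball weakly compact and N the closed cone of nonpositive
operators; a compact set plus a closed set is closed. -/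
theorem isClosed_wot_boundedLowerSet (hF : IsClosed[M.sigmaWeak] F) (r : ℝ) :
    IsClosed (toCLM ⁻¹' boundedLowerSet F r) := by
  have hK : IsCompact (toCLM ⁻¹' ((↑) '' F ∩ Metric.closedBall (0 : H →L[ℂ] H) r)) :=
    (isCompact_preimage_closedBall r).of_isClosed_subset
      (isClosed_wot_of_isClosed_sigmaWeak hF r) fun _ hy ↦ hy.2
  have hN : IsClosed {x : H →WOT[ℂ] H | x.toCLM ≤ 0} := by
    simpa using isClosed_nonneg.preimage (continuous_neg (G := H →WOT[ℂ] H))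
  convert M.isClosed_wot.inter (hN.add_left_of_isCompact hK) using 1
  ext x
  constructor
  · rintro ⟨hx, y, hy, hyr, hxy⟩
    refine ⟨hx, ofCLM y, ⟨⟨y, hy, rfl⟩, mem_closedBall_zero_iff.2 hyr⟩, x - ofCLM y, ?_, ?_⟩
    · exact sub_nonpos.2 hxy
    · exact add_sub_cancel _ _
  · rintro ⟨hx, a, ⟨⟨y, hy, hya⟩, har⟩, b, hb, rfl⟩
    refine ⟨hx, y, hy, hya ▸ mem_closedBall_zero_iff.1 har, ?_⟩
    rw [hya]
    exact add_le_of_nonpos_right hb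

theorem convex_dominatedSet (hF : Convex ℝ F) : Convex ℝ (dominatedSet F) := by
  rintro x ⟨hx, x', hx', hxx'⟩ y ⟨hy, y', hy', hyy'⟩ a b ha hb hab
  refine ⟨(a • (⟨x, hx⟩ : M) + b • (⟨y, hy⟩ : M)).2, _, hF hx' hy' ha hb hab, ?_⟩
  exact add_le_add (smul_le_smul_of_nonneg_left hxx' ha) (smul_le_smul_of_nonneg_left hyy' hb)

theorem isSelfAdjoint_of_mem_closure_dominatedSet (hpos : F ⊆ M.posCone) {x : H →L[ℂ] H}
    (hx : x ∈ closure (dominatedSet F)) : IsSelfAdjoint x := by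
  refine closure_minimal (t := {z | IsSelfAdjoint z}) (fun z hz ↦ ?_)
    (isClosed_eq continuous_star continuous_id) hx
  obtain ⟨-, y, hy, hzy⟩ := hz
  have h1 : IsSelfAdjoint ((y : H →L[ℂ] H) - z) := .of_nonneg (sub_nonneg.2 hzy)
  have h2 : IsSelfAdjoint (y : H →L[ℂ] H) := .of_nonneg (hpos hy)
  simpa using! h2.sub h1

/-- If x ≤ y ∈ F, the approximation of y dominates that of x, has norm at most 1/α, and stays in F
by heredity since it lies between 0 and y. -/
theorem yosida_mem_boundedLowerSet (hpos : F ⊆ M.posCone) (hher : IsHereditary F) {α : ℝ}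
    (hα : 0 < α) {x : H →L[ℂ] H} (hx : x ∈ dominatedSet F) (hαx : α * ‖x‖ ≤ 1 / 2) :
    yosida α x ∈ boundedLowerSet F α⁻¹ := by
  have hsa := isSelfAdjoint_of_mem_closure_dominatedSet hpos (subset_closure hx)
  obtain ⟨hxM, y, hy, hxy⟩ := hx
  have hy0 : (0 : H →L[ℂ] H) ≤ y := hpos hy
  refine ⟨M.yosida_mem α hxM, ⟨yosida α y, M.yosida_mem α y.2⟩, ?_, norm_yosida_le hα hy0, ?_⟩
  · exact hher (yosida_nonneg hα.le hy0) (yosida_le hα hy0) hy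
  · exact yosida_le_yosida hα.le (hsa.isStrictlyPositive_one_add_smul hα.le hαx) hxy

theorem yosida_mem_boundedLowerSet_of_tendsto (hF : IsClosed[M.sigmaWeak] F) {α : ℝ}
    (hα : 0 < α) {ι : Type*} {l : Filter ι} [l.NeBot] {c : ι → H →L[ℂ] H} {x : H →L[ℂ] H}
    (hx : α * ‖x‖ ≤ 1 / 2) (hc : ∀ᶠ i in l, α * ‖c i‖ ≤ 1 / 2)
    (hcF : ∀ᶠ i in l, yosida α (c i) ∈ boundedLowerSet F α⁻¹)
    (h : ∀ ξ, Tendsto (fun i ↦ c i ξ) l (𝓝 (x ξ))) :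
    yosida α x ∈ boundedLowerSet F α⁻¹ :=
  (isClosed_wot_boundedLowerSet hF α⁻¹).mem_of_tendsto
    (tendsto_ofCLM_of_tendsto_apply (tendsto_yosida_apply hα hx hc h)) hcF

/-- The extra 1 in the bound on α leaves room for approximants of x whose norms slightly exceed ‖x‖.
-/
theorem yosida_mem_boundedLowerSet_of_mem_closure (hpos : F ⊆ M.posCone) (hher : IsHereditary F)
    (hF : IsClosed[M.sigmaWeak] F) {α : ℝ} (hα : 0 < α) {x : H →L[ℂ] H}
    (hx : x ∈ closure (dominatedSet F)) (hαx : α * (‖x‖ + 1) ≤ 1 / 2) :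
    yosida α x ∈ boundedLowerSet F α⁻¹ := by
  obtain ⟨d, hd, hdx⟩ := mem_closure_iff_seq_limit.1 hx
  have hαd : ∀ᶠ n in atTop, α * ‖d n‖ ≤ 1 / 2 := by
    filter_upwards [hdx.norm.eventually_le_const (lt_add_one ‖x‖)] with n hn
    exact (mul_le_mul_of_nonneg_left hn hα.le).trans hαx
  refine yosida_mem_boundedLowerSet_of_tendsto hF hα (l := atTop) (c := d) ?_ hαd ?_ fun ξ ↦ ?_
  · exact (mul_le_mul_of_nonneg_left (le_add_of_nonneg_right zero_le_one) hα.le).trans hαx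
  · filter_upwards [hαd] with n hn
    exact yosida_mem_boundedLowerSet hpos hher hα (hd n) hn
  · exact ((ContinuousLinearMap.apply ℂ H ξ).continuous.tendsto x).comp hdx

theorem eventually_mul_le (c : ℝ) : ∀ᶠ α : ℝ in 𝓝[>] 0, 0 < α ∧ α * c ≤ 1 / 2 := by
  have h : Tendsto (fun α : ℝ ↦ α * c) (𝓝[>] 0) (𝓝 0) :=
    (Continuous.tendsto' (by fun_prop) 0 0 (by simp)).mono_left nhdsWithin_le_nhds
  filter_upwards [self_mem_nhdsWithin, h.eventually_le_const (show (0 : ℝ) < 1 / 2 by norm_num)]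
    with α hα hαc using ⟨hα, hαc⟩

/-- The bounded parts of the norm closure of `F - M^+` are weakly closed. -/
theorem isClosed_wot_closure_dominatedSet (hpos : F ⊆ M.posCone) (hconv : Convex ℝ F)
    (hher : IsHereditary F) (hF : IsClosed[M.sigmaWeak] F) (r : ℝ) :
    IsClosed (toCLM ⁻¹' (closure (dominatedSet F) ∩ Metric.closedBall 0 r)) := by
  classical
  refine isClosed_of_closure_subset fun x hx ↦ ?_
  have hxr : ‖x.toCLM‖ ≤ r := mem_closedBall_zero_iff.1 <|
    closure_minimal (fun _ hy ↦ hy.2) (isClosed_preimage_closedBall r) hx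
  obtain ⟨c, hc, hcx⟩ := ((convex_dominatedSet hconv).closure.inter
    (convex_closedBall _ r)).exists_tendsto_apply_of_mem_closure_wot (x := x.toCLM) hx
  -- The weak limit x is the norm limit of its Yosida approximations, so it is enough that these
  -- belong to F - M^+ for small α.
  refine ⟨mem_closure_of_tendsto (tendsto_yosida_zero x.toCLM) ?_, mem_closedBall_zero_iff.2 hxr⟩
  filter_upwards [eventually_mul_le (r + 1)] with α ⟨hα, hαr⟩
  have bound {z : H →L[ℂ] H} (hz : ‖z‖ ≤ r) : α * (‖z‖ + 1) ≤ 1 / 2 := le_trans (by gcongr) hαr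
  have bound' {z : H →L[ℂ] H} (hz : ‖z‖ ≤ r) : α * ‖z‖ ≤ 1 / 2 :=
    le_trans (by gcongr; linarith) hαr
  have hcr (i) : ‖c i‖ ≤ r := mem_closedBall_zero_iff.1 (hc i).2
  exact boundedLowerSet_subset _ <| yosida_mem_boundedLowerSet_of_tendsto hF hα (bound' hxr)
    (.of_forall fun i ↦ bound' (hcr i)) (.of_forall fun i ↦
      yosida_mem_boundedLowerSet_of_mem_closure hpos hher hF hα (hc i).1 (bound (hcr i))) hcx

/-- The positive elements of the norm closure of `F - M^+` belong to `F`. -/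
theorem mem_of_mem_closure_dominatedSet (hpos : F ⊆ M.posCone)
    (hher : IsHereditary F) (hF : IsClosed[M.sigmaWeak] F) {x : M} (hx0 : x ∈ M.posCone)
    (hx : (x : H →L[ℂ] H) ∈ closure (dominatedSet F)) : x ∈ F := by
  have hx0' : (0 : H →L[ℂ] H) ≤ x := hx0
  let c : ℝ → M := fun α ↦ ⟨yosida α x, M.yosida_mem α x.2⟩
  have hcx : Tendsto (fun α ↦ (c α : H →L[ℂ] H)) (𝓝[>] 0) (𝓝 x) := tendsto_yosida_zero _
  have hlim : Tendsto c (𝓝[>] 0) (@nhds _ M.sigmaWeak x) := by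
    refine tendsto_sigmaWeak (hcx.norm.eventually_le_const (lt_add_one _))
      (tendsto_ofCLM_of_tendsto_apply fun ξ ↦ ?_)
    exact ((ContinuousLinearMap.apply ℂ H ξ).continuous.tendsto _).comp hcx
  let _ := M.sigmaWeak
  refine hF.mem_of_tendsto hlim ?_
  filter_upwards [eventually_mul_le (‖(x : H →L[ℂ] H)‖ + 1)] with α ⟨hα, hαx⟩
  obtain ⟨-, y, hy, -, hxy⟩ := yosida_mem_boundedLowerSet_of_mem_closure hpos hher hF hα hx hαx
  exact hher (yosida_nonneg hα.le hx0') hxy hy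

end VonNeumannAlgebra

/-! ### Separation by a positive normal functional and the bipolar theorem. -/

namespace VonNeumannAlgebra

variable {H : Type*} [NormedAddCommGroup H] [InnerProductSpace ℂ H] [CompleteSpace H]
  {M : VonNeumannAlgebra H} {F : Set M}

/-- A functional taking real values on self-adjoint elements is self-adjoint. -/
theorem mem_predualSA_of_im_eq_zero {ω : M.predual}
    (h : ∀ x : M, IsSelfAdjoint x → (ω.1 x).im = 0) : ω ∈ M.predualSA := by
  intro x
  have h1 := h (x + star x) (.add_star_self x)
  have h2 := h (Complex.I • (x - star x)) <| Subtype.ext <| by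
    change star (Complex.I • ((x : H →L[ℂ] H) - star (x : H →L[ℂ] H))) = _
    rw [star_smul, star_sub, star_star, Complex.star_def, Complex.conj_I, neg_smul, ← smul_neg,
      neg_sub]
    rfl
  rw [map_add, Complex.add_im] at h1
  rw [map_smul, map_sub, smul_eq_mul, Complex.I_mul_im, Complex.sub_re] at h2
  refine Complex.ext ?_ ?_
  · simpa using (sub_eq_zero.1 h2).symm
  · simpa using eq_neg_of_add_eq_zero_right h1

/-- A positive element outside a `σ`-weakly closed convex hereditary set `F` is strictly separated
from `F` by a self-adjoint positive normal functional. -/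
theorem exists_predualPos_separation (hne : F.Nonempty) (hpos : F ⊆ M.posCone)
    (hF : IsClosed[M.sigmaWeak] F) (hconv : Convex ℝ F) (hher : IsHereditary F)
    {x₀ : M} (hx₀ : x₀ ∈ M.posCone) (hx₀F : x₀ ∉ F) :
    ∃ ω ∈ M.predualSA ∩ M.predualPos, 1 < (ω.1 x₀).re ∧ ∀ x ∈ F, (ω.1 x).re ≤ 1 := by
  have hzero : (0 : M) ∈ F := by
    obtain ⟨y, hy⟩ := hne
    exact hher le_rfl (hpos hy) hy
  let a : H →L[ℂ] H := x₀
  -- Translating by x₀ moves the point to be separated to the origin.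
  let C : Set (H →L[ℂ] H) := (fun z ↦ z + a) ⁻¹' closure (dominatedSet F)
  have hCsa : ∀ x ∈ C, IsSelfAdjoint x := fun x hx ↦ by
    have h1 : IsSelfAdjoint a := .of_nonneg hx₀
    simpa using (isSelfAdjoint_of_mem_closure_dominatedSet hpos hx).sub h1
  have hCwot (r : ℝ) : IsClosed (toCLM ⁻¹' (C ∩ Metric.closedBall 0 r)) := by
    have h1 := (isClosed_wot_closure_dominatedSet hpos hconv hher hF (r + ‖a‖)).preimage
      (continuous_add_const (ofCLM a))
    convert h1.inter (isClosed_preimage_closedBall r) using 1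
    ext x
    refine ⟨fun hx ↦ ⟨⟨hx.1, mem_closedBall_zero_iff.2 ?_⟩, hx.2⟩, fun hx ↦ ⟨hx.1.1, hx.2⟩⟩
    exact (norm_add_le _ _).trans (add_le_add (mem_closedBall_zero_iff.1 hx.2) le_rfl)
  obtain ⟨ξ, η, him, δ, hδ, hsep⟩ :=
    ((convex_dominatedSet hconv).closure.translate_preimage_left a).exists_normal_separation
      hCsa (isClosed_closure.preimage (continuous_add_const a)) hCwot fun h ↦
        hx₀F (mem_of_mem_closure_dominatedSet hpos hher hF hx₀ (by simpa [C] using h))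
  let φ : M.predual := vectorFunctional M ξ η
  have hφim (x : M) (hx : IsSelfAdjoint x) : (φ.1 x).im = 0 :=
    him x (congrArg Subtype.val hx)
  have hφ (x : M) (hx : (x : H →L[ℂ] H) ∈ dominatedSet F) :
      (φ.1 x₀).re + δ ≤ (φ.1 x).re := by
    have h1 : δ ≤ (φ.1 (x - x₀)).re := hsep (x - x₀) (by
      simpa [C, a] using subset_closure hx)
    rw [map_sub, Complex.sub_re] at h1
    linarith
  have hφF (x : M) (hx : x ∈ F) : (φ.1 x₀).re + δ ≤ (φ.1 x).re := hφ x ⟨x.2, x, hx, le_rfl⟩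
  -- Since 0 ∈ F, every -n x with x ≥ 0 is dominated by a member of F; a positive value at x would
  -- make φ unbounded below there.
  have hφpos (x : M) (hx : x ∈ M.posCone) : (φ.1 x).re ≤ 0 := by
    by_contra! hcon
    obtain ⟨n, hn⟩ := exists_nat_gt (-((φ.1 x₀).re + δ) / (φ.1 x).re)
    have hx' : (0 : H →L[ℂ] H) ≤ x := hx
    have h1 := hφ (-((n : ℝ) : ℂ) • x) ⟨Subtype.prop _, 0, hzero, by
      change -((n : ℝ) : ℂ) • (x : H →L[ℂ] H) ≤ 0
      rw [neg_smul, neg_nonpos, Complex.coe_smul]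
      exact smul_nonneg n.cast_nonneg hx'⟩
    rw [map_smul, smul_eq_mul, neg_mul, Complex.neg_re, Complex.re_ofReal_mul] at h1
    rw [div_lt_iff₀ hcon] at hn
    linarith
  have h0 : (φ.1 x₀).re + δ ≤ 0 := by simpa using hφF 0 hzero
  -- On F, -φ is at most -φ(x₀) - δ. Scaling the midpoint -φ(x₀) - δ/2 to 1 puts x₀ strictly above 1
  -- and F below; the midpoint is positive because 0 ∈ F.
  let t : ℝ := (-(φ.1 x₀).re - δ / 2)⁻¹
  have ht : 0 < t := inv_pos.2 (by linarith)
  have htinv : t * (-(φ.1 x₀).re - δ / 2) = 1 := inv_mul_cancel₀ (by linarith)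
  let ω : M.predual := (-(t : ℂ)) • φ
  have hω (x : M) : ω.1 x = -((t : ℂ) * φ.1 x) := neg_mul _ _
  have hωre (x : M) : (ω.1 x).re = t * -(φ.1 x).re := by
    rw [hω, Complex.neg_re, Complex.re_ofReal_mul, mul_neg]
  have hωim (x : M) (hx : IsSelfAdjoint x) : (ω.1 x).im = 0 := by
    rw [hω, Complex.neg_im, Complex.im_ofReal_mul, hφim x hx, mul_zero, neg_zero]
  refine ⟨ω, ⟨mem_predualSA_of_im_eq_zero hωim, fun x hx ↦ ?_⟩, ?_, fun x hx ↦ ?_⟩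
  · have hxsa : IsSelfAdjoint x := Subtype.ext (IsSelfAdjoint.of_nonneg (show 0 ≤ x.1 from hx))
    rw [Complex.nonneg_iff, hωre, hωim x hxsa]
    exact ⟨mul_nonneg ht.le (neg_nonneg.2 (hφpos x hx)), rfl⟩
  · rw [hωre, ← htinv]
    gcongr
    linarith
  · rw [hωre, ← htinv]
    have := hφF x hx
    gcongr
    linarith

end VonNeumannAlgebra

theorem theorem3p1 {H : Type*} [NormedAddCommGroup H] [InnerProductSpace ℂ H] [CompleteSpace H]
    (M : VonNeumannAlgebra H) (F : Set M) (hne : F.Nonempty) (hpos : F ⊆ M.posCone)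
    (hclosed : IsClosed[M.sigmaWeak] F) (hconv : Convex ℝ F) (hher : IsHereditary F) :
    F = VonNeumannAlgebra.posPrepolar (VonNeumannAlgebra.posPolar F) ∧
      ∀ x' ∈ M.posCone \ F, ∃ ω ∈ M.predualPos,
        1 < (ω.1 x').re ∧ ∀ x ∈ F, (ω.1 x).re ≤ 1 := by
  refine ⟨Set.Subset.antisymm (fun x hx ↦ ⟨⟨?_, fun ω hω ↦ hω.1.2 x hx⟩, hpos hx⟩) ?_, ?_⟩
  · exact Subtype.ext (IsSelfAdjoint.of_nonneg (show 0 ≤ x.1 from hpos hx))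
  · rintro x ⟨⟨-, hx⟩, hx0⟩
    by_contra hxF
    obtain ⟨ω, hω, h1, h2⟩ := VonNeumannAlgebra.exists_predualPos_separation hne hpos hclosed
      hconv hher hx0 hxF
    exact absurd h1 (hx ω ⟨⟨hω.1, h2⟩, hω.2⟩).not_gt
  · rintro x ⟨hx0, hxF⟩
    obtain ⟨ω, hω, h⟩ := VonNeumannAlgebra.exists_predualPos_separation hne hpos hclosed
      hconv hher hx0 hxF
    exact ⟨ω, hω.2, h⟩
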